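/- For an integer $d\ge 1$ let $\mathcal F_d$ be the set of upper semi-continuous, log-concave probability densities on $\mathbb R^d$ with respect to Lebesgue measure, that is, densities of the form $f=e^{\phi}$ with $\phi:\mathbb R^d\to[-\infty,\infty)$ concave and upper semi-continuous. For $f\in\mathcal F_d$ put $\mu_f=\int_{\mathbb R^d} x f(x)\,dx$ and $\Sigma_f=\int_{\mathbb R^d}(x-\mu_f)(x-\mu_f)^{T}f(x)\,dx$, and let $\mathcal F_d^{0,I}=\{f\in\mathcal F_d:\mu_f=0,\ \Sigma_f=I\}$. Let $\|\cdot\|$ denote the Euclidean norm. (a) For each integer $d\ge 1$ there exist $A_{0,d},B_{0,d}>0$, depending only on $d$, such that for all $x\in\mathbb R^d$, $$\sup_{f\in\mathcal F_d^{0,I}} f(x)\le e^{-A_{0,d}\|x\|+B_{0,d}}.$$ (b) For each integer $d\ge 1$ and every $x\in\mathbb R^d$ with $\|x\|\le 1/4$, $$\inf_{f\in\mathcal F_d^{0,I}} f(x)>0.$$ -/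

import Mathlib

open MeasureTheory

/-- A function `f : E → ℝ` is log-concave if `f = exp φ` for a concave `φ : E → [-∞, ∞)`.
Written multiplicatively, so that the value `0 = exp (-∞)` is allowed: `f` is nonnegative and
`f x ^ a * f y ^ b ≤ f (a x + b y)` for all positive weights `a + b = 1`. -/
def IsLogConcave {E : Type*} [AddCommGroup E] [Module ℝ E] (f : E → ℝ) : Prop :=
  (∀ x, 0 ≤ f x) ∧
    ∀ x y : E, ∀ a b : ℝ, 0 < a → 0 < b → a + b = 1 →
      f x ^ a * f y ^ b ≤ f (a • x + b • y)

/-- The class `ℱ_d` of upper semicontinuous, log-concave probability densities on `ℝ^d`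
with respect to Lebesgue measure. -/
def logConcaveDensities (d : ℕ) : Set (EuclideanSpace ℝ (Fin d) → ℝ) :=
  {f | UpperSemicontinuous f ∧ IsLogConcave f ∧ Integrable f ∧ ∫ x, f x = 1}

/-- The mean vector `μ_f = ∫ x f(x) dx`. -/
noncomputable def densityMean {d : ℕ} (f : EuclideanSpace ℝ (Fin d) → ℝ) :
    EuclideanSpace ℝ (Fin d) :=
  ∫ x, f x • x

/-- The covariance matrix `Σ_f = ∫ (x - μ_f) (x - μ_f)ᵀ f(x) dx`, entry by entry. -/
noncomputable def densityCov {d : ℕ} (f : EuclideanSpace ℝ (Fin d) → ℝ) :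
    Matrix (Fin d) (Fin d) ℝ :=
  Matrix.of fun i j => ∫ x, (x i - densityMean f i) * (x j - densityMean f j) * f x

/-- The class `ℱ_d^{μ,Σ}` of those `f ∈ ℱ_d` with mean `m` and covariance matrix `S`.
(Log-concave densities have finite moments of all orders, so the integrals defining the mean
and the covariance converge for every `f ∈ ℱ_d`.) -/
def logConcaveDensitiesWith (d : ℕ) (m : EuclideanSpace ℝ (Fin d))
    (S : Matrix (Fin d) (Fin d) ℝ) : Set (EuclideanSpace ℝ (Fin d) → ℝ) :=
  {f | f ∈ logConcaveDensities d ∧ densityMean f = m ∧ densityCov f = S}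

/-! Both parts rest on one uniform fact: every half-space `1/4 ≤ ⟪w, x⟫` with `‖w‖ = 1` has mass
greater than `exp (-3) / 2` under each isotropic log-concave density. By Prékopa–Leindler, the tails
of `⟪w, x⟫` are log-concave. If the half-space had too little mass, `X = 1/4 - ⟪w, x⟫` would be
almost a positive variable. Its negative part would then have exponentially small moments, so its
positive part would have a small mean but a second moment of at least `1`. Comparing the tail with
an exponential rules this out (`first_moment_le_of_logConcave`).

Lower bound: if `f x₀ < ε` with `‖x₀‖ ≤ 1/4`, a hyperplane separates `x₀` from the closed convex set
`{ε ≤ f}`, so `{f < ε}` contains such a half-space up to shrinking. By Chebyshev, `{f < ε}` has mass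
at most `exp (-3) / 2` once `ε` is small in terms of `d`, a contradiction.

Upper bound: a large value `f x`, interpolated with the lower bound `c` near the origin, makes `f`
large on a ball of radius `1/8` around `l • x`. The mass of that ball is at most `1`, and is small
by Chebyshev when `l • x` is far out. -/

open scoped ENNReal Pointwise

/-! ### Brunn–Minkowski and Prékopa–Leindler inequalities -/

theorem volume_image_mul_add {a : ℝ} (ha : 0 < a) (c : ℝ) (K : Set ℝ) :
    volume ((fun x => a * x + c) '' K) = ENNReal.ofReal a * volume K := by
  have h : (fun x => a * x + c) '' K = (fun z => z + c) '' (a • K) := by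
    rw [← Set.image_smul, Set.image_image]
    simp [smul_eq_mul]
  rw [h, Set.image_add_right, measure_preimage_add_right, Measure.addHaar_smul]
  simp [abs_of_pos ha]

/-- With `p = max K` and `q = min L`, the sets `a K + b q` and `a p + b L` both lie in `C` and meet
at most in the point `a p + b q`, so their volumes add. -/
theorem IsCompact.volume_combination_le {K L C : Set ℝ} (hK : IsCompact K) (hL : IsCompact L)
    (hK0 : K.Nonempty) (hL0 : L.Nonempty) {a b : ℝ} (ha : 0 < a) (hb : 0 < b)
    (h : ∀ x ∈ K, ∀ y ∈ L, a * x + b * y ∈ C) :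
    ENNReal.ofReal a * volume K + ENNReal.ofReal b * volume L ≤ volume C := by
  obtain ⟨p, hpK, hp⟩ := hK.exists_isGreatest hK0
  obtain ⟨q, hqL, hq⟩ := hL.exists_isLeast hL0
  have e1 := volume_image_mul_add ha (b * q) K
  have e2 := volume_image_mul_add hb (a * p) L
  rw [← e1, ← e2]
  have hm : MeasurableSet ((fun y => b * y + a * p) '' L) :=
    (hL.image (by fun_prop)).measurableSet
  have hd : AEDisjoint volume ((fun x => a * x + b * q) '' K) ((fun y => b * y + a * p) '' L) := by
    refine measure_mono_null (t := {a * p + b * q}) ?_ (by simp)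
    rintro _ ⟨⟨x, hx, rfl⟩, ⟨y, hy, hxy⟩⟩
    have h1 := mul_le_mul_of_nonneg_left (hp hx) ha.le
    have h2 := mul_le_mul_of_nonneg_left (hq hy) hb.le
    simp only [Set.mem_singleton_iff] at hxy ⊢
    linarith
  rw [← measure_union₀ hm.nullMeasurableSet hd]
  apply measure_mono
  rintro _ (⟨x, hx, rfl⟩ | ⟨y, hy, rfl⟩)
  · exact h x hx q hqL
  · have := h p hpK y hy
    rwa [add_comm] at this

/-- The one-dimensional Brunn–Minkowski inequality. -/
theorem MeasurableSet.volume_combination_le {A B C : Set ℝ} (hA : MeasurableSet A)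
    (hB : MeasurableSet B) (hA0 : A.Nonempty) (hB0 : B.Nonempty) {a b : ℝ}
    (ha : 0 < a) (hb : 0 < b) (h : ∀ x ∈ A, ∀ y ∈ B, a * x + b * y ∈ C) :
    ENNReal.ofReal a * volume A + ENNReal.ofReal b * volume B ≤ volume C := by
  obtain ⟨p, hp⟩ := hA0
  obtain ⟨q, hq⟩ := hB0
  rw [hA.measure_eq_iSup_isCompact, hB.measure_eq_iSup_isCompact]
  simp only [ENNReal.mul_iSup, iSup_and']
  refine ENNReal.biSup_add_biSup_le' (p := fun K => K ⊆ A ∧ IsCompact K)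
    (q := fun L => L ⊆ B ∧ IsCompact L) ⟨∅, Set.empty_subset _, isCompact_empty⟩
    ⟨∅, Set.empty_subset _, isCompact_empty⟩ ?_
  rintro K ⟨hKA, hK⟩ L ⟨hLB, hL⟩
  -- The approximating compact sets may be empty; inserting `p` and `q` supplies the extrema that
  -- the compact case needs.
  have := IsCompact.volume_combination_le (K := insert p K) (L := insert q L) (C := C)
    (hK.insert p) (hL.insert q) (by simp) (by simp) ha hb ?_
  · refine le_trans ?_ this
    gcongr <;> exact Set.subset_insert _ _
  · rintro x hx y hy
    refine h x ?_ y ?_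
    · rcases hx with rfl | hx
      · exact hp
      · exact hKA hx
    · rcases hy with rfl | hy
      · exact hq
      · exact hLB hy

theorem lintegral_eq_lintegral_volume_lt {f : ℝ → ℝ≥0∞} (hf : Measurable f)
    (hfin : ∀ x, f x ≠ ∞) :
    ∫⁻ x, f x = ∫⁻ t in Set.Ioi (0 : ℝ), volume {x | ENNReal.ofReal t < f x} := by
  have h := lintegral_eq_lintegral_meas_lt (volume : Measure ℝ) (f := fun x => (f x).toReal)
    (Filter.Eventually.of_forall fun _ => ENNReal.toReal_nonneg) hf.ennreal_toReal.aemeasurable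
  simp only [ENNReal.ofReal_toReal (hfin _)] at h
  rw [h]
  refine setLIntegral_congr_fun measurableSet_Ioi fun t ht => ?_
  congr 1
  ext x
  simp only [Set.mem_ofPred_eq]
  rw [ENNReal.ofReal_lt_iff_lt_toReal (le_of_lt ht) (hfin x)]

theorem ENNReal.rpow_mul_rpow_le_add {a b : ℝ} (ha : 0 < a) (hb : 0 < b) (hab : a + b = 1)
    (u v : ℝ≥0∞) : u ^ a * v ^ b ≤ ENNReal.ofReal a * u + ENNReal.ofReal b * v := by
  by_cases hu : u = ∞
  · have : ENNReal.ofReal a * u = ∞ := by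
      rw [hu, ENNReal.mul_top]; simpa using ha
    simp [this]
  by_cases hv : v = ∞
  · have : ENNReal.ofReal b * v = ∞ := by
      rw [hv, ENNReal.mul_top]; simpa using hb
    simp [this]
  lift u to NNReal using hu
  lift v to NNReal using hv
  have h := NNReal.geom_mean_le_arith_mean2_weighted a.toNNReal b.toNNReal u v (by
    rw [← Real.toNNReal_add ha.le hb.le, hab, Real.toNNReal_one])
  rw [Real.coe_toNNReal _ ha.le, Real.coe_toNNReal _ hb.le] at h
  rw [← ENNReal.coe_rpow_of_nonneg _ ha.le, ← ENNReal.coe_rpow_of_nonneg _ hb.le]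
  simp only [ENNReal.ofReal]
  exact_mod_cast h

/-- Equal suprema make the superlevel sets of `f` and `g` nonempty for exactly the same levels `t <
1`. Brunn–Minkowski then applies level by level, and the layer-cake formula integrates the result.
-/
theorem lintegral_combination_le_of_iSup_eq_one {f g h : ℝ → ℝ≥0∞} (hf : Measurable f)
    (hg : Measurable g) (hh : Measurable h) {a b : ℝ} (ha : 0 < a) (hb : 0 < b) (hab : a + b = 1)
    (hfgh : ∀ x y, f x ^ a * g y ^ b ≤ h (a * x + b * y))
    (hf1 : ⨆ x, f x = 1) (hg1 : ⨆ x, g x = 1) :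
    ENNReal.ofReal a * (∫⁻ x, f x) + ENNReal.ofReal b * ∫⁻ x, g x ≤ ∫⁻ x, h x := by
  have hfle : ∀ x, f x ≤ 1 := fun x => hf1 ▸ le_iSup f x
  have hgle : ∀ x, g x ≤ 1 := fun x => hg1 ▸ le_iSup g x
  calc ENNReal.ofReal a * (∫⁻ x, f x) + ENNReal.ofReal b * ∫⁻ x, g x
      -- Truncating `h` at `1` makes it finite for the layer-cake formula and costs nothing, since
      -- levels `t ≥ 1` contribute nothing on the left.
      ≤ ∫⁻ x, min (h x) 1 := by
        rw [lintegral_eq_lintegral_volume_lt hf fun x => ((hfle x).trans_lt ENNReal.one_lt_top).ne,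
          lintegral_eq_lintegral_volume_lt hg fun x => ((hgle x).trans_lt ENNReal.one_lt_top).ne,
          lintegral_eq_lintegral_volume_lt (hh.min measurable_const)
            fun x => ((min_le_right _ _).trans_lt ENNReal.one_lt_top).ne]
        have mono : ∀ k : ℝ → ℝ≥0∞, Antitone fun t : ℝ => volume {x | ENNReal.ofReal t < k x} :=
          fun k s t hst => measure_mono fun x hx => (ENNReal.ofReal_le_ofReal hst).trans_lt hx
        rw [← lintegral_const_mul _ (mono f).measurable, ← lintegral_const_mul _ (mono g).measurable,
          ← lintegral_add_left ((mono f).measurable.const_mul _)]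
        refine setLIntegral_mono' measurableSet_Ioi fun t ht => ?_
        rcases lt_or_ge t 1 with h1 | h1
        · have ht1 : ENNReal.ofReal t < 1 := by simpa using h1
          refine MeasurableSet.volume_combination_le (measurableSet_lt measurable_const hf)
            (measurableSet_lt measurable_const hg) ?_ ?_ ha hb ?_
          · rw [← hf1] at ht1; exact lt_iSup_iff.1 ht1
          · rw [← hg1] at ht1; exact lt_iSup_iff.1 ht1
          · intro x hx y hy
            refine lt_min (lt_of_lt_of_le ?_ (hfgh x y)) ht1
            calc ENNReal.ofReal t = ENNReal.ofReal t ^ a * ENNReal.ofReal t ^ b := by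
                  rw [← ENNReal.rpow_add_of_nonneg _ _ ha.le hb.le, hab, ENNReal.rpow_one]
              _ < f x ^ a * g y ^ b :=
                  ENNReal.mul_lt_mul (ENNReal.rpow_lt_rpow hx ha) (ENNReal.rpow_lt_rpow hy hb)
        · have ht1 : 1 ≤ ENNReal.ofReal t := by simpa using h1
          have e1 : {x | ENNReal.ofReal t < f x} = ∅ := by
            ext x; simpa using (hfle x).trans ht1
          have e2 : {x | ENNReal.ofReal t < g x} = ∅ := by
            ext x; simpa using (hgle x).trans ht1
          simp [e1, e2]
    _ ≤ ∫⁻ x, h x := lintegral_mono fun x => min_le_left _ _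

theorem prekopa_leindler_real_of_bounded {f g h : ℝ → ℝ≥0∞} (hf : Measurable f)
    (hg : Measurable g) (hh : Measurable h) {a b : ℝ} (ha : 0 < a) (hb : 0 < b) (hab : a + b = 1)
    (hfgh : ∀ x y, f x ^ a * g y ^ b ≤ h (a * x + b * y))
    (hf1 : ⨆ x, f x ≠ ∞) (hg1 : ⨆ x, g x ≠ ∞) :
    (∫⁻ x, f x) ^ a * (∫⁻ x, g x) ^ b ≤ ∫⁻ x, h x := by
  set F := ⨆ x, f x with hF
  set G := ⨆ x, g x with hG
  by_cases hF0 : F = 0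
  · have : ∀ x, f x = 0 := by simpa [hF, ENNReal.iSup_eq_zero] using hF0
    simp [this, ha]
  by_cases hG0 : G = 0
  · have : ∀ x, g x = 0 := by simpa [hG, ENNReal.iSup_eq_zero] using hG0
    simp [this, hb]
  have hFi : F⁻¹ ^ a ≠ ∞ := ENNReal.rpow_ne_top_of_nonneg ha.le (by simpa)
  have hGi : G⁻¹ ^ b ≠ ∞ := ENNReal.rpow_ne_top_of_nonneg hb.le (by simpa)
  -- Dividing `f`, `g` by their suprema and `h` by `F ^ a * G ^ b` preserves the hypothesis; the
  -- weighted AM–GM inequality then turns the arithmetic mean into the geometric one.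
  have key := lintegral_combination_le_of_iSup_eq_one (f := fun x => F⁻¹ * f x)
    (g := fun x => G⁻¹ * g x) (h := fun x => F⁻¹ ^ a * G⁻¹ ^ b * h x)
    (hf.const_mul _) (hg.const_mul _) (hh.const_mul _) ha hb hab ?_ ?_ ?_
  · have h2 := (ENNReal.rpow_mul_rpow_le_add ha hb hab (∫⁻ x, F⁻¹ * f x)
      (∫⁻ x, G⁻¹ * g x)).trans key
    rw [lintegral_const_mul _ hf, lintegral_const_mul _ hg, lintegral_const_mul _ hh,
      ENNReal.mul_rpow_of_nonneg _ _ ha.le, ENNReal.mul_rpow_of_nonneg _ _ hb.le,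
      mul_mul_mul_comm] at h2
    refine (ENNReal.mul_le_mul_iff_right ?_ (ENNReal.mul_ne_top hFi hGi)).1 h2
    simp [ha.le, hb.le, ha, hb, hf1, hg1]
  · intro x y
    rw [ENNReal.mul_rpow_of_nonneg _ _ ha.le, ENNReal.mul_rpow_of_nonneg _ _ hb.le,
      mul_mul_mul_comm]
    gcongr
    exact hfgh x y
  · rw [← ENNReal.mul_iSup, ENNReal.inv_mul_cancel hF0 hf1]
  · rw [← ENNReal.mul_iSup, ENNReal.inv_mul_cancel hG0 hg1]

theorem iSup_lintegral_min_natCast {α : Type*} [MeasurableSpace α] {μ : Measure α}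
    {f : α → ℝ≥0∞} (hf : Measurable f) :
    ⨆ n : ℕ, ∫⁻ x, min (f x) n ∂μ = ∫⁻ x, f x ∂μ := by
  rw [← lintegral_iSup (fun n => hf.min measurable_const)]
  · refine lintegral_congr fun x => ?_
    have : ⨆ n : ℕ, min (f x) n = min (f x) (⨆ n : ℕ, (n : ℝ≥0∞)) := by
      rw [← inf_iSup_eq]
    rw [this, ENNReal.iSup_natCast]
    simp
  · intro m n hmn x
    exact min_le_min le_rfl (by exact_mod_cast hmn)

/-- The one-dimensional Prékopa–Leindler inequality. -/
theorem prekopa_leindler_real {f g h : ℝ → ℝ≥0∞} (hf : Measurable f)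
    (hg : Measurable g) (hh : Measurable h) {a b : ℝ} (ha : 0 < a) (hb : 0 < b) (hab : a + b = 1)
    (hfgh : ∀ x y, f x ^ a * g y ^ b ≤ h (a * x + b * y)) :
    (∫⁻ x, f x) ^ a * (∫⁻ x, g x) ^ b ≤ ∫⁻ x, h x := by
  by_cases hf0 : ∫⁻ x, f x = 0
  · simp [hf0, ha]
  by_cases hg0 : ∫⁻ x, g x = 0
  · simp [hg0, hb]
  have tend : ∀ k : ℝ → ℝ≥0∞, Measurable k →
      Filter.Tendsto (fun n : ℕ => ∫⁻ x, min (k x) n) Filter.atTop (nhds (∫⁻ x, k x)) := by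
    intro k hk
    rw [← iSup_lintegral_min_natCast hk]
    refine tendsto_atTop_iSup fun m n hmn => lintegral_mono fun x => ?_
    exact min_le_min le_rfl (by exact_mod_cast hmn)
  -- The two integrals are nonzero, so the product of the limits avoids the discontinuity of
  -- multiplication at `0 * ∞`.
  refine le_of_tendsto (ENNReal.Tendsto.mul ((tend f hf).ennrpow_const a) (.inl ?_)
    ((tend g hg).ennrpow_const b) (.inl ?_)) (Filter.Eventually.of_forall fun n => ?_)
  · simp [hf0, ha.le, ha]
  · simp [hg0, hb.le, hb]
  · refine prekopa_leindler_real_of_bounded (hf.min measurable_const) (hg.min measurable_const) hh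
      ha hb hab (fun x y => ?_) ?_ ?_
    · refine le_trans ?_ (hfgh x y)
      gcongr <;> exact min_le_left _ _
    · exact ((iSup_le fun x => min_le_right _ _).trans_lt (ENNReal.natCast_lt_top n)).ne
    · exact ((iSup_le fun x => min_le_right _ _).trans_lt (ENNReal.natCast_lt_top n)).ne

/-- The Prékopa–Leindler inequality on `ℝⁿ`. -/
theorem prekopa_leindler_pi (n : ℕ) {f g h : (Fin n → ℝ) → ℝ≥0∞} (hf : Measurable f)
    (hg : Measurable g) (hh : Measurable h) {a b : ℝ} (ha : 0 < a) (hb : 0 < b) (hab : a + b = 1)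
    (hfgh : ∀ x y, f x ^ a * g y ^ b ≤ h (a • x + b • y)) :
    (∫⁻ x, f x) ^ a * (∫⁻ x, g x) ^ b ≤ ∫⁻ x, h x := by
  induction n with
  | zero =>
    have e : ∀ k : (Fin 0 → ℝ) → ℝ≥0∞, ∫⁻ x, k x = k 0 := by
      intro k
      rw [lintegral_unique, volume_pi, Measure.pi_univ]
      rw [Fin.prod_univ_zero, mul_one]
      exact congrArg k (Subsingleton.elim _ _)
    rw [e, e, e]
    simpa using hfgh 0 0
  | succ n ih =>
    let E := (MeasurableEquiv.piFinSuccAbove (fun _ : Fin (n + 1) => ℝ) 0).symm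
    have hE : MeasurePreserving E := (volume_preserving_piFinSuccAbove (fun _ => ℝ) 0).symm
    have e : ∀ k : (Fin (n + 1) → ℝ) → ℝ≥0∞, Measurable k →
        ∫⁻ x, k x = ∫⁻ t, ∫⁻ v, k (E (t, v)) := by
      intro k hk
      rw [← hE.lintegral_comp hk, Measure.volume_eq_prod,
        lintegral_prod (fun z => k (E z)) (hk.comp E.measurable).aemeasurable]
    have m : ∀ k : (Fin (n + 1) → ℝ) → ℝ≥0∞, Measurable k →
        Measurable fun t => ∫⁻ v, k (E (t, v)) :=
      fun k hk => (hk.comp E.measurable).lintegral_prod_right'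
    have m' : ∀ k : (Fin (n + 1) → ℝ) → ℝ≥0∞, Measurable k → ∀ t,
        Measurable fun v => k (E (t, v)) :=
      fun k hk t => hk.comp (E.measurable.comp measurable_prodMk_left)
    rw [e f hf, e g hg, e h hh]
    -- The marginals in the first coordinate satisfy the one-dimensional hypothesis by the inductive
    -- hypothesis on fibres.
    refine prekopa_leindler_real (m f hf) (m g hg) (m h hh) ha hb hab fun s t => ?_
    refine ih (m' f hf _) (m' g hg _) (m' h hh _) fun v w => ?_
    refine (hfgh _ _).trans_eq ?_
    congr 1
    ext i
    refine Fin.cases ?_ (fun j => ?_) i <;> simp [E, MeasurableEquiv.piFinSuccAbove]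

/-- The Prékopa–Leindler inequality on Euclidean space. -/
theorem prekopa_leindler {n : ℕ} {f g h : EuclideanSpace ℝ (Fin n) → ℝ≥0∞} (hf : Measurable f)
    (hg : Measurable g) (hh : Measurable h) {a b : ℝ} (ha : 0 < a) (hb : 0 < b) (hab : a + b = 1)
    (hfgh : ∀ x y, f x ^ a * g y ^ b ≤ h (a • x + b • y)) :
    (∫⁻ x, f x) ^ a * (∫⁻ x, g x) ^ b ≤ ∫⁻ x, h x := by
  have hE := PiLp.volume_preserving_toLp (Fin n)
  rw [← hE.lintegral_comp hf, ← hE.lintegral_comp hg, ← hE.lintegral_comp hh]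
  refine prekopa_leindler_pi n (hf.comp hE.measurable) (hg.comp hE.measurable)
    (hh.comp hE.measurable) ha hb hab fun x y => ?_
  exact hfgh _ _

/-! ### Comparison of log-concave functions with exponentials -/

theorem lintegral_Ioi_const_mul_exp {c r : ℝ} (hc : 0 ≤ c) (hr : 0 < r) :
    ∫⁻ t in Set.Ioi (0 : ℝ), ENNReal.ofReal (c * Real.exp (-(r * t))) =
      ENNReal.ofReal (c / r) := by
  have hi : IntegrableOn (fun t : ℝ => Real.exp (-(r * t))) (Set.Ioi 0) := by
    simpa [neg_mul] using integrableOn_exp_mul_Ioi (neg_lt_zero.2 hr) 0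
  rw [← ofReal_integral_eq_lintegral_ofReal (hi.const_mul c)
    (Filter.Eventually.of_forall fun t => by positivity), integral_const_mul]
  have := integral_exp_mul_Ioi (neg_lt_zero.2 hr) 0
  simp only [neg_mul] at this
  rw [this]
  congr 1
  simp [field]

theorem lintegral_Ioi_mul_const_mul_exp {c r : ℝ} (hc : 0 ≤ c) (hr : 0 < r) :
    ∫⁻ t in Set.Ioi (0 : ℝ), ENNReal.ofReal (t * (c * Real.exp (-(r * t)))) =
      ENNReal.ofReal (c / r ^ 2) := by
  have hi : IntegrableOn (fun t : ℝ => t * Real.exp (-(r * t))) (Set.Ioi 0) := by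
    simpa [neg_mul] using
      integrableOn_rpow_mul_exp_neg_mul_rpow (s := 1) (p := 1) (by norm_num) one_pos hr
  have e : ∀ t : ℝ, t * (c * Real.exp (-(r * t))) = c * (t * Real.exp (-(r * t))) := by
    intro t; ring
  simp only [e]
  rw [← ofReal_integral_eq_lintegral_ofReal (hi.const_mul c), integral_const_mul]
  · have := Real.integral_rpow_mul_exp_neg_mul_Ioi (a := 2) two_pos hr
    norm_num at this
    rw [this]
    congr 1
  · filter_upwards [ae_restrict_mem measurableSet_Ioi] with t ht
    have : 0 < t := ht
    simp only [Pi.zero_apply]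
    positivity

/-- For a log-concave function on `[0, ∞)` whose integral is small compared to that of
`T 0 * exp (-2 t)`, the first moment is bounded by that of `T 0 * exp (-2 t)`. -/
theorem first_moment_le_of_logConcave {T : ℝ → ℝ} (hT : Antitone T) (hT0 : 0 < T 0)
    (hpos : ∀ t, 0 ≤ T t)
    (hlog : ∀ s t a b : ℝ, 0 < a → 0 < b → a + b = 1 → T s ^ a * T t ^ b ≤ T (a * s + b * t))
    {I₁ I₂ : ℝ} (hI₁ : ∫⁻ t in Set.Ioi (0 : ℝ), ENNReal.ofReal (T t) = ENNReal.ofReal I₁)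
    (hI₂ : ∫⁻ t in Set.Ioi (0 : ℝ), ENNReal.ofReal (t * T t) = ENNReal.ofReal I₂)
    (hI₁0 : 0 ≤ I₁) (hI₂0 : 0 ≤ I₂) (h : I₁ < T 0 / 2) : I₂ ≤ T 0 / 4 := by
  set E : ℝ → ℝ := fun t => T 0 * Real.exp (-(2 * t)) with hE
  have hEpos : ∀ t, 0 < E t := fun t => by positivity
  have hEm : Measurable E := by fun_prop
  -- `log E` is affine and `E 0 = T 0`, so concavity of `log T` makes `{E ≤ T}` an initial interval
  -- of the half-line.
  have down : ∀ s t, 0 ≤ s → s ≤ t → E t ≤ T t → E s ≤ T s := by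
    intro s t hs hst ht
    rcases hs.eq_or_lt with rfl | hs
    · simp [hE]
    rcases hst.eq_or_lt with rfl | hst
    · exact ht
    have ht0 : 0 < t := hs.trans hst
    have hb : 0 < s / t := by positivity
    have ha : 0 < 1 - s / t := by rw [sub_pos, div_lt_one ht0]; exact hst
    have h1 := hlog 0 t (1 - s / t) (s / t) ha hb (by ring)
    rw [mul_zero, zero_add, div_mul_cancel₀ _ ht0.ne'] at h1
    refine le_trans ?_ h1
    calc E s = T 0 ^ (1 - s / t) * E t ^ (s / t) := by
          simp only [hE]
          rw [Real.mul_rpow hT0.le (Real.exp_pos _).le, ← mul_assoc, ← Real.rpow_add hT0,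
            ← Real.exp_mul]
          rw [sub_add_cancel, Real.rpow_one]
          congr 2
          field_simp
      _ ≤ _ := by
          gcongr
  obtain ⟨s₁, hs₁, hs₁'⟩ : ∃ s, 0 < s ∧ T s < E s := by
    by_contra! hcon
    have : ENNReal.ofReal (T 0 / 2) ≤ ENNReal.ofReal I₁ := by
      rw [← hI₁, ← lintegral_Ioi_const_mul_exp hT0.le two_pos]
      exact setLIntegral_mono' measurableSet_Ioi fun t ht => ENNReal.ofReal_le_ofReal (hcon t ht)
    rw [ENNReal.ofReal_le_ofReal_iff hI₁0] at this
    linarith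
  let A : Set ℝ := {t | 0 ≤ t ∧ E t ≤ T t}
  have h0A : (0 : ℝ) ∈ A := ⟨le_rfl, by simp [hE]⟩
  have hbdd : BddAbove A := by
    refine ⟨s₁, fun t ht => ?_⟩
    by_contra! hlt
    exact absurd (down s₁ t hs₁.le hlt.le ht.2) (not_le.2 hs₁')
  set s₀ := sSup A
  have hs₀ : 0 ≤ s₀ := le_csSup hbdd h0A
  -- This is `(t - s₀) * (T t - E t) ≤ 0`, arranged without subtraction for use with `lintegral`.
  -- Integrated, it reads `I₂ - T 0 / 4 ≤ s₀ * (I₁ - T 0 / 2) ≤ 0`.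
  have cross : ∀ t, 0 < t → t * T t + s₀ * E t ≤ s₀ * T t + t * E t := by
    intro t ht
    rcases lt_trichotomy t s₀ with hlt | heq | hgt
    · obtain ⟨u, hu, htu⟩ := exists_lt_of_lt_csSup ⟨0, h0A⟩ hlt
      have := down t u ht.le htu.le hu.2
      nlinarith
    · rw [heq]
    · have : T t < E t := by
        by_contra! hle
        exact absurd (le_csSup hbdd (show t ∈ A from ⟨ht.le, hle⟩)) (not_le.2 hgt)
      nlinarith
  have hTm : Measurable T := hT.measurable
  have key : ENNReal.ofReal (I₂ + s₀ * (T 0 / 2)) ≤ ENNReal.ofReal (s₀ * I₁ + T 0 / 2 ^ 2) := by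
    rw [ENNReal.ofReal_add hI₂0 (by positivity), ENNReal.ofReal_add (by positivity) (by positivity),
      ENNReal.ofReal_mul hs₀, ENNReal.ofReal_mul hs₀, ← hI₁, ← hI₂,
      ← lintegral_Ioi_const_mul_exp hT0.le two_pos,
      ← lintegral_Ioi_mul_const_mul_exp hT0.le two_pos,
      ← lintegral_const_mul _ hEm.ennreal_ofReal, ← lintegral_const_mul _ hTm.ennreal_ofReal,
      ← lintegral_add_left (f := fun t => ENNReal.ofReal (t * T t))
        (measurable_id.mul hTm).ennreal_ofReal,
      ← lintegral_add_left (hTm.ennreal_ofReal.const_mul _)]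
    refine setLIntegral_mono' measurableSet_Ioi fun t ht => ?_
    have ht : 0 < t := ht
    rw [← ENNReal.ofReal_mul hs₀, ← ENNReal.ofReal_mul hs₀,
      ← ENNReal.ofReal_add (mul_nonneg ht.le (hpos t)) (mul_nonneg hs₀ (hEpos t).le),
      ← ENNReal.ofReal_add (mul_nonneg hs₀ (hpos t)) (mul_nonneg ht.le (hEpos t).le)]
    exact ENNReal.ofReal_le_ofReal (cross t ht)
  rw [ENNReal.ofReal_le_ofReal_iff (by positivity)] at key
  nlinarith

/-! ### Random variables with log-concave tails -/

/-- The tail function `s ↦ μ {s ≤ X}` is log-concave. -/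
def HasLogConcaveTail {Ω : Type*} [MeasurableSpace Ω] (μ : Measure Ω) (X : Ω → ℝ) : Prop :=
  ∀ s t a b : ℝ, 0 < a → 0 < b → a + b = 1 →
    μ.real {x | s ≤ X x} ^ a * μ.real {x | t ≤ X x} ^ b ≤ μ.real {x | a * s + b * t ≤ X x}

section Tail

variable {Ω : Type*} [MeasurableSpace Ω] {μ : Measure Ω} {X : Ω → ℝ}

theorem antitone_measureReal_le [IsFiniteMeasure μ] :
    Antitone fun t : ℝ => μ.real {x | t ≤ X x} :=
  fun _ _ hst => measureReal_mono fun _ hx => hst.trans hx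

theorem lintegral_tail_eq_ofReal [IsFiniteMeasure μ] (hi : Integrable X μ) :
    ∫⁻ t in Set.Ioi (0 : ℝ), ENNReal.ofReal (μ.real {x | t ≤ X x}) =
      ENNReal.ofReal (∫ x, max (X x) 0 ∂μ) := by
  have hm : Integrable (fun x => max (X x) 0) μ := hi.pos_part
  have hnn : 0 ≤ᵐ[μ] fun x => max (X x) 0 := Filter.Eventually.of_forall fun x => le_max_right _ _
  rw [ofReal_integral_eq_lintegral_ofReal hm hnn,
    lintegral_eq_lintegral_meas_le μ hnn hm.aestronglyMeasurable.aemeasurable]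
  refine setLIntegral_congr_fun measurableSet_Ioi fun t ht => ?_
  have ht : ¬ t ≤ 0 := not_le.2 ht
  simp [ht]

theorem lintegral_mul_tail_eq_ofReal [IsFiniteMeasure μ] (hi : AEMeasurable X μ)
    (hi2 : Integrable (fun x => X x ^ 2) μ) :
    ∫⁻ t in Set.Ioi (0 : ℝ), ENNReal.ofReal (t * μ.real {x | t ≤ X x}) =
      ENNReal.ofReal ((∫ x, max (X x) 0 ^ 2 ∂μ) / 2) := by
  have hX : AEMeasurable (fun x => max (X x) 0) μ := hi.max aemeasurable_const
  have hm : Integrable (fun x => max (X x) 0 ^ 2) μ := by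
    refine hi2.mono' (hX.pow_const 2).aestronglyMeasurable (Filter.Eventually.of_forall fun x => ?_)
    rw [Real.norm_of_nonneg (by positivity)]
    rcases le_total (X x) 0 with h | h
    · rw [max_eq_right h]; simpa using sq_nonneg (X x)
    · rw [max_eq_left h]
  have hnn : 0 ≤ᵐ[μ] fun x => max (X x) 0 := Filter.Eventually.of_forall fun x => le_max_right _ _
  have h := lintegral_rpow_eq_lintegral_meas_le_mul μ hnn hX (p := 2) two_pos
  simp only [Real.rpow_two] at h
  rw [← ofReal_integral_eq_lintegral_ofReal hm
    (Filter.Eventually.of_forall fun x => sq_nonneg _)] at h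
  rw [div_eq_inv_mul, ENNReal.ofReal_mul (by norm_num), h, ← mul_assoc,
    ← ENNReal.ofReal_mul (by norm_num)]
  norm_num
  refine setLIntegral_congr_fun measurableSet_Ioi fun t ht => ?_
  have ht' : 0 < t := ht
  simp only [not_le.2 ht', or_false]
  rw [ENNReal.ofReal_mul ht'.le, ofReal_measureReal, mul_comm]

/-- The bound is the log-affine function with value `1/2` at `-3` and `exp (-3) / 2` at `0`. A tail
exceeding it at `t`, interpolated with the value at `-3`, would be too large at `0`. -/
theorem tail_le_exp_of_logConcave (hlog : HasLogConcaveTail μ X)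
    (h0 : μ.real {x | 0 ≤ X x} ≤ Real.exp (-3) / 2) (h3 : 1 / 2 ≤ μ.real {x | -3 ≤ X x})
    {t : ℝ} (ht : 0 < t) :
    μ.real {x | t ≤ X x} ≤ Real.exp (-3) / 2 * Real.exp (-(1 * t)) := by
  by_contra! hlt
  have ha : 0 < t / (t + 3) := by positivity
  have hb : 0 < 3 / (t + 3) := by positivity
  have hab : t / (t + 3) + 3 / (t + 3) = 1 := by field_simp
  have h := hlog (-3) t _ _ ha hb hab
  have e0 : t / (t + 3) * -3 + 3 / (t + 3) * t = 0 := by ring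
  rw [e0] at h
  have hstrict : (1 / 2 : ℝ) ^ (t / (t + 3)) *
      (Real.exp (-3) / 2 * Real.exp (-(1 * t))) ^ (3 / (t + 3)) <
      μ.real {x | -3 ≤ X x} ^ (t / (t + 3)) * μ.real {x | t ≤ X x} ^ (3 / (t + 3)) := by
    have h1 := Real.rpow_lt_rpow (by positivity) hlt hb
    have h2 := Real.rpow_le_rpow (by norm_num) h3 ha.le
    have : (0 : ℝ) < (1 / 2 : ℝ) ^ (t / (t + 3)) := by positivity
    calc _ < (1 / 2 : ℝ) ^ (t / (t + 3)) * μ.real {x | t ≤ X x} ^ (3 / (t + 3)) := by gcongr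
      _ ≤ _ := by gcongr
  have heq : (1 / 2 : ℝ) ^ (t / (t + 3)) *
      (Real.exp (-3) / 2 * Real.exp (-(1 * t))) ^ (3 / (t + 3)) = Real.exp (-3) / 2 := by
    have : Real.exp (-3) / 2 * Real.exp (-(1 * t)) = (1 / 2) * Real.exp (-3 - t) := by
      rw [sub_eq_add_neg, Real.exp_add]; ring_nf
    rw [this, Real.mul_rpow (by norm_num) (Real.exp_pos _).le, ← mul_assoc,
      ← Real.rpow_add (by norm_num), hab, Real.rpow_one, ← Real.exp_mul]
    have : (-3 - t) * (3 / (t + 3)) = -3 := by field_simp; ring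
    rw [this]; ring
  linarith

/-- A random variable with mean `1/4` and second moment `17/16` whose two tails are log-concave
takes nonpositive values with a probability bounded below by a universal constant. -/
theorem exp_neg_three_half_lt_measureReal_nonpos [IsProbabilityMeasure μ]
    (hlog : HasLogConcaveTail μ X) (hlog' : HasLogConcaveTail μ fun x => -X x)
    (hX : Measurable X) (hX2 : Integrable (fun x => X x ^ 2) μ)
    (h1 : ∫ x, X x ∂μ = 1 / 4) (h2 : ∫ x, X x ^ 2 ∂μ = 17 / 16) :
    Real.exp (-3) / 2 < μ.real {x | X x ≤ 0} := by
  by_contra! hle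
  -- A non-integrable function has integral `0` by convention, so a nonzero mean forces
  -- integrability.
  have hX1 : Integrable X μ := by
    by_contra hcon
    rw [integral_undef hcon] at h1
    norm_num at h1
  have he : Real.exp (-3) / 2 ≤ 1 / 32 := by
    have h27 : (2.7 : ℝ) ^ 3 ≤ Real.exp 1 ^ 3 := by
      gcongr; linarith [Real.exp_one_gt_d9]
    rw [← Real.exp_nat_mul, show ((3 : ℕ) : ℝ) * 1 = 3 by norm_num] at h27
    rw [Real.exp_neg, div_le_iff₀ two_pos, inv_le_comm₀ (Real.exp_pos _) (by norm_num)]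
    linarith
  have hneg0 : μ.real {x | 0 ≤ -X x} ≤ Real.exp (-3) / 2 := by simpa using hle
  -- Markov's inequality: `9 ≤ X ^ 2` has probability at most `17/144`.
  have hneg3 : 1 / 2 ≤ μ.real {x | -3 ≤ -X x} := by
    have hm := mul_meas_ge_le_integral_of_nonneg
      (Filter.Eventually.of_forall fun x => sq_nonneg (X x)) hX2 9
    have hc : 1 - μ.real {x | 9 ≤ X x ^ 2} ≤ μ.real {x | -3 ≤ -X x} := by
      rw [← probReal_compl_eq_one_sub (measurableSet_le measurable_const (hX.pow_const 2))]
      refine measureReal_mono fun x hx => ?_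
      simp only [Set.mem_compl_iff, Set.mem_ofPred_eq, not_le] at hx ⊢
      nlinarith
    rw [h2] at hm
    linarith
  have hpos0 : 31 / 32 ≤ μ.real {x | 0 ≤ X x} := by
    have hc : 1 - μ.real {x | X x ≤ 0} ≤ μ.real {x | 0 ≤ X x} := by
      rw [← probReal_compl_eq_one_sub (measurableSet_le hX measurable_const)]
      refine measureReal_mono fun x hx => ?_
      simp only [Set.mem_compl_iff, Set.mem_ofPred_eq, not_le] at hx ⊢
      exact hx.le
    linarith
  have hle1 : μ.real {x | 0 ≤ X x} ≤ 1 := measureReal_le_one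
  have decay := fun t (ht : 0 < t) => tail_le_exp_of_logConcave hlog' hneg0 hneg3 ht
  have n2 : Integrable (fun x => (-X x) ^ 2) μ := by simpa using hX2
  have m1 : ∫ x, max (-X x) 0 ∂μ ≤ 1 / 32 := by
    have : ENNReal.ofReal (∫ x, max (-X x) 0 ∂μ) ≤ ENNReal.ofReal (Real.exp (-3) / 2 / 1) := by
      rw [← lintegral_tail_eq_ofReal (X := fun x => -X x) hX1.neg, ← lintegral_Ioi_const_mul_exp (by positivity) one_pos]
      exact setLIntegral_mono' measurableSet_Ioi fun t ht => ENNReal.ofReal_le_ofReal (decay t ht)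
    rw [ENNReal.ofReal_le_ofReal_iff (by positivity)] at this
    linarith
  have m2 : (∫ x, max (-X x) 0 ^ 2 ∂μ) / 2 ≤ 1 / 32 := by
    have : ENNReal.ofReal ((∫ x, max (-X x) 0 ^ 2 ∂μ) / 2) ≤
        ENNReal.ofReal (Real.exp (-3) / 2 / 1 ^ 2) := by
      rw [← lintegral_mul_tail_eq_ofReal (X := fun x => -X x) hX.neg.aemeasurable n2,
        ← lintegral_Ioi_mul_const_mul_exp (by positivity) one_pos]
      refine setLIntegral_mono' measurableSet_Ioi fun t ht => ENNReal.ofReal_le_ofReal ?_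
      exact mul_le_mul_of_nonneg_left (decay t ht) (le_of_lt ht)
    rw [ENNReal.ofReal_le_ofReal_iff (by positivity)] at this
    linarith
  have p1 : ∫ x, max (X x) 0 ∂μ = 1 / 4 + ∫ x, max (-X x) 0 ∂μ := by
    have hn : Integrable (fun x => max (-X x) 0) μ := hX1.neg.pos_part
    rw [← h1, ← integral_add hX1 hn]
    refine integral_congr_ae (Filter.Eventually.of_forall fun x => ?_)
    rcases le_total (X x) 0 with h | h
    · simp only [max_eq_right h, max_eq_left (neg_nonneg.2 h)]; ring
    · simp only [max_eq_left h, max_eq_right (neg_nonpos.2 h)]; ring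
  have p2 : ∫ x, max (X x) 0 ^ 2 ∂μ = 17 / 16 - ∫ x, max (-X x) 0 ^ 2 ∂μ := by
    have hm : Integrable (fun x => max (-X x) 0 ^ 2) μ := by
      refine hX2.mono' ((hX.neg.max measurable_const).pow_const 2).aestronglyMeasurable
        (Filter.Eventually.of_forall fun x => ?_)
      rw [Real.norm_of_nonneg (by positivity)]
      rcases le_total (-X x) 0 with h | h
      · rw [max_eq_right h]; simpa using sq_nonneg (X x)
      · rw [max_eq_left h, neg_sq]
    rw [← h2, ← integral_sub hX2 hm]
    refine integral_congr_ae (Filter.Eventually.of_forall fun x => ?_)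
    rcases le_total (X x) 0 with h | h
    · simp only [max_eq_right h, max_eq_left (neg_nonneg.2 h)]; ring
    · simp only [max_eq_left h, max_eq_right (neg_nonpos.2 h)]; ring
  -- The positive part has mean at most `1/4 + 1/32`, below `T 0 / 2 ≥ 31/64`, so half its second
  -- moment is at most `T 0 / 4 ≤ 1/4`. But its second moment is at least `17/16 - 1/16 = 1`.
  have fin := first_moment_le_of_logConcave (T := fun t => μ.real {x | t ≤ X x})
    antitone_measureReal_le (by linarith) (fun t => measureReal_nonneg) hlog
    (lintegral_tail_eq_ofReal hX1) (lintegral_mul_tail_eq_ofReal hX.aemeasurable hX2)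
    (integral_nonneg fun x => le_max_right _ _)
    (div_nonneg (integral_nonneg fun x => sq_nonneg _) two_pos.le) (by linarith)
  linarith

end Tail

/-! ### Half-spaces and superlevel sets of isotropic log-concave densities -/

/-- The measure with density `f` with respect to Lebesgue measure. -/
noncomputable def densityMeasure {d : ℕ} (f : EuclideanSpace ℝ (Fin d) → ℝ) :
    Measure (EuclideanSpace ℝ (Fin d)) :=
  volume.withDensity fun x => ENNReal.ofReal (f x)

section Density

variable {d : ℕ} {f : EuclideanSpace ℝ (Fin d) → ℝ}

theorem measurable_of_mem_logConcaveDensities (hf : f ∈ logConcaveDensities d) : Measurable f :=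
  hf.1.measurable

theorem isProbabilityMeasure_densityMeasure (hf : f ∈ logConcaveDensities d) :
    IsProbabilityMeasure (densityMeasure f) := by
  constructor
  rw [densityMeasure, withDensity_apply _ MeasurableSet.univ, Measure.restrict_univ,
    ← ofReal_integral_eq_lintegral_ofReal hf.2.2.1 (Filter.Eventually.of_forall hf.2.1.1),
    hf.2.2.2, ENNReal.ofReal_one]

theorem densityMeasure_apply {s : Set (EuclideanSpace ℝ (Fin d))} (hs : MeasurableSet s) :
    densityMeasure f s = ∫⁻ x, s.indicator (fun x => ENNReal.ofReal (f x)) x := by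
  rw [densityMeasure, withDensity_apply _ hs, lintegral_indicator hs]

theorem integral_densityMeasure (hf : f ∈ logConcaveDensities d) {F : Type*}
    [NormedAddCommGroup F] [NormedSpace ℝ F] (g : EuclideanSpace ℝ (Fin d) → F) :
    ∫ x, g x ∂densityMeasure f = ∫ x, f x • g x := by
  rw [densityMeasure, integral_withDensity_eq_integral_toReal_smul
    (measurable_of_mem_logConcaveDensities hf).ennreal_ofReal (by simp)]
  simp [ENNReal.toReal_ofReal (hf.2.1.1 _)]

/-- Prékopa–Leindler applied to `f` restricted to three half-spaces: convex combinations of points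
of the first two lie in the third. -/
theorem hasLogConcaveTail_inner_add (hf : f ∈ logConcaveDensities d)
    (w : EuclideanSpace ℝ (Fin d)) (c : ℝ) :
    HasLogConcaveTail (densityMeasure f) fun x => inner ℝ w x + c := by
  intro s t a b ha hb hab
  have := isProbabilityMeasure_densityMeasure hf
  have hm : ∀ r : ℝ, MeasurableSet {x : EuclideanSpace ℝ (Fin d) | r ≤ inner ℝ w x + c} :=
    fun r => measurableSet_le measurable_const (by fun_prop)
  have hfm := (measurable_of_mem_logConcaveDensities hf).ennreal_ofReal
  have h := prekopa_leindler (hfm.indicator (hm s)) (hfm.indicator (hm t))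
    (hfm.indicator (hm (a * s + b * t))) ha hb hab ?_
  · rw [← densityMeasure_apply (hm _), ← densityMeasure_apply (hm _),
      ← densityMeasure_apply (hm _)] at h
    have h' := ENNReal.toReal_mono (measure_ne_top _ _) h
    rwa [ENNReal.toReal_mul, ← ENNReal.toReal_rpow, ← ENNReal.toReal_rpow] at h'
  · intro x y
    by_cases hx : s ≤ inner ℝ w x + c
    · by_cases hy : t ≤ inner ℝ w y + c
      · have hxy : a * s + b * t ≤ inner ℝ w (a • x + b • y) + c := by
          rw [inner_add_right, real_inner_smul_right, real_inner_smul_right]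
          have h1 := mul_le_mul_of_nonneg_left hx ha.le
          have h2 := mul_le_mul_of_nonneg_left hy hb.le
          have h3 : c = a * c + b * c := by rw [← add_mul, hab, one_mul]
          linarith
        rw [Set.indicator_of_mem (by exact hx), Set.indicator_of_mem (by exact hy),
          Set.indicator_of_mem (by exact hxy), ENNReal.ofReal_rpow_of_nonneg (hf.2.1.1 _) ha.le,
          ENNReal.ofReal_rpow_of_nonneg (hf.2.1.1 _) hb.le,
          ← ENNReal.ofReal_mul (Real.rpow_nonneg (hf.2.1.1 _) _)]
        exact ENNReal.ofReal_le_ofReal (hf.2.1.2 x y a b ha hb hab)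
      · rw [Set.indicator_of_notMem (a := y) (by exact hy)]
        simp [hb]
    · rw [Set.indicator_of_notMem (a := x) (by exact hx)]
      simp [ha]

variable (hf : f ∈ logConcaveDensitiesWith d 0 1)
include hf

theorem integral_mul_of_isotropic (i j : Fin d) :
    ∫ x, x i * x j ∂densityMeasure f = if i = j then 1 else 0 := by
  obtain ⟨h0, hmean, hcov⟩ := hf
  rw [integral_densityMeasure h0]
  have := congrFun (congrFun hcov i) j
  simp only [densityCov, hmean, Matrix.of_apply, PiLp.zero_apply, sub_zero, Matrix.one_apply] at this
  rw [← this]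
  refine integral_congr_ae (Filter.Eventually.of_forall fun x => ?_)
  simp [mul_comm]

/-- The unit diagonal of the covariance already forces integrability, because a divergent integral
would be `0` by convention. -/
theorem integrable_sq_of_isotropic (i : Fin d) :
    Integrable (fun x => x i ^ 2) (densityMeasure f) := by
  by_contra hcon
  have h := integral_mul_of_isotropic hf i i
  simp only [← sq] at h
  rw [integral_undef hcon] at h
  simp at h

theorem integrable_mul_of_isotropic (i j : Fin d) :
    Integrable (fun x => x i * x j) (densityMeasure f) := by
  refine ((integrable_sq_of_isotropic hf i).add (integrable_sq_of_isotropic hf j)).mono'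
    (by fun_prop) (Filter.Eventually.of_forall fun x => ?_)
  simp only [Real.norm_eq_abs, abs_mul, Pi.add_apply]
  nlinarith [sq_nonneg (|x i| - |x j|), sq_abs (x i), sq_abs (x j), sq_nonneg (x i),
    sq_nonneg (x j)]

theorem integrable_norm_sq_of_isotropic :
    Integrable (fun x => ‖x‖ ^ 2) (densityMeasure f) := by
  simp only [EuclideanSpace.real_norm_sq_eq]
  exact integrable_finsetSum _ fun i _ => integrable_sq_of_isotropic hf i

theorem integral_norm_sq_of_isotropic : ∫ x, ‖x‖ ^ 2 ∂densityMeasure f = d := by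
  simp only [EuclideanSpace.real_norm_sq_eq]
  rw [integral_finsetSum _ fun i _ => integrable_sq_of_isotropic hf i]
  simp only [sq, integral_mul_of_isotropic hf]
  simp

theorem integrable_id_of_isotropic : Integrable (fun x => x) (densityMeasure f) := by
  have := isProbabilityMeasure_densityMeasure hf.1
  refine ((integrable_const (1 : ℝ)).add (integrable_norm_sq_of_isotropic hf)).mono'
    (by fun_prop) (Filter.Eventually.of_forall fun x => ?_)
  simp only [Pi.add_apply]
  nlinarith [sq_nonneg (‖x‖ - 1)]

theorem integral_inner_of_isotropic (w : EuclideanSpace ℝ (Fin d)) :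
    ∫ x, inner ℝ w x ∂densityMeasure f = 0 := by
  rw [integral_inner (integrable_id_of_isotropic hf), integral_densityMeasure hf.1]
  have : ∫ x, f x • x = (0 : EuclideanSpace ℝ (Fin d)) := hf.2.1
  rw [this, inner_zero_right]

omit hf in
theorem inner_sq_eq_sum (w x : EuclideanSpace ℝ (Fin d)) :
    inner ℝ w x ^ 2 = ∑ i, ∑ j, w i * w j * (x i * x j) := by
  rw [PiLp.inner_apply, sq, Finset.sum_mul_sum]
  refine Finset.sum_congr rfl fun i _ => Finset.sum_congr rfl fun j _ => ?_
  simp only [RCLike.inner_apply, conj_trivial]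
  ring

theorem integrable_inner_sq_of_isotropic (w : EuclideanSpace ℝ (Fin d)) :
    Integrable (fun x => inner ℝ w x ^ 2) (densityMeasure f) := by
  simp only [inner_sq_eq_sum]
  exact integrable_finsetSum _ fun i _ => integrable_finsetSum _ fun j _ =>
    (integrable_mul_of_isotropic hf i j).const_mul _

theorem integral_inner_sq_of_isotropic (w : EuclideanSpace ℝ (Fin d)) :
    ∫ x, inner ℝ w x ^ 2 ∂densityMeasure f = ‖w‖ ^ 2 := by
  simp only [inner_sq_eq_sum]
  rw [integral_finsetSum _ fun i _ => integrable_finsetSum _ fun j _ =>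
    (integrable_mul_of_isotropic hf i j).const_mul _]
  have : ∀ i, ∫ x, ∑ j, w i * w j * (x i * x j) ∂densityMeasure f = w i ^ 2 := by
    intro i
    rw [integral_finsetSum _ fun j _ => (integrable_mul_of_isotropic hf i j).const_mul _]
    simp only [integral_const_mul, integral_mul_of_isotropic hf]
    simp [sq]
  simp only [this, EuclideanSpace.real_norm_sq_eq]

theorem measureReal_norm_ge_le {R : ℝ} (hR : 0 < R) :
    (densityMeasure f).real {x | R ≤ ‖x‖} ≤ d / R ^ 2 := by
  have h := mul_meas_ge_le_integral_of_nonneg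
    (Filter.Eventually.of_forall fun x => sq_nonneg ‖x‖) (integrable_norm_sq_of_isotropic hf) (R ^ 2)
  rw [integral_norm_sq_of_isotropic hf] at h
  have e : {x : EuclideanSpace ℝ (Fin d) | R ≤ ‖x‖} = {x | R ^ 2 ≤ ‖x‖ ^ 2} := by
    ext x
    exact (pow_le_pow_iff_left₀ hR.le (norm_nonneg x) two_ne_zero).symm
  rw [e, le_div_iff₀ (by positivity), mul_comm]
  exact h

theorem exp_neg_three_half_lt_measureReal_halfspace {w : EuclideanSpace ℝ (Fin d)} (hw : ‖w‖ = 1) :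
    Real.exp (-3) / 2 < (densityMeasure f).real {x | 1 / 4 ≤ inner ℝ w x} := by
  have := isProbabilityMeasure_densityMeasure hf.1
  have hi : Integrable (fun x => inner ℝ w x) (densityMeasure f) :=
    (integrable_id_of_isotropic hf).const_inner w
  have hi2 := integrable_inner_sq_of_isotropic hf w
  have e : ∀ x : EuclideanSpace ℝ (Fin d), (1 / 4 - inner ℝ w x) ^ 2 =
      (1 / 16 - 1 / 2 * inner ℝ w x) + inner ℝ w x ^ 2 := by intro x; ring
  have hi' : Integrable (fun x => 1 / 16 - 1 / 2 * inner ℝ w x) (densityMeasure f) :=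
    (integrable_const _).sub (hi.const_mul _)
  have h := exp_neg_three_half_lt_measureReal_nonpos (μ := densityMeasure f)
    (X := fun x => 1 / 4 - inner ℝ w x) ?_ ?_ (by fun_prop) ?_ ?_ ?_
  · simpa only [sub_nonpos] using h
  · simpa [neg_add_eq_sub] using hasLogConcaveTail_inner_add hf.1 (-w) (1 / 4)
  · simpa [sub_eq_add_neg] using hasLogConcaveTail_inner_add hf.1 w (-(1 / 4))
  · simp only [e]
    exact hi'.add hi2
  · rw [integral_sub (integrable_const _) hi, integral_inner_of_isotropic hf]
    simp
  · simp only [e]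
    rw [integral_add hi' hi2, integral_sub (integrable_const _) (hi.const_mul _),
      integral_const_mul, integral_inner_of_isotropic hf, integral_inner_sq_of_isotropic hf, hw]
    norm_num

/-- Outside the ball of radius `R` Chebyshev bounds the mass; inside it the density is below `ε`. -/
theorem measureReal_lt_le {R ε : ℝ} (hR : 0 < R) (hε : 0 ≤ ε) :
    (densityMeasure f).real {x | f x < ε} ≤
      d / R ^ 2 + ε * volume.real (Metric.ball (0 : EuclideanSpace ℝ (Fin d)) R) := by
  have := isProbabilityMeasure_densityMeasure hf.1
  have hm : MeasurableSet ({x | f x < ε} ∩ Metric.ball 0 R) :=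
    (measurableSet_lt (measurable_of_mem_logConcaveDensities hf.1) measurable_const).inter
      measurableSet_ball
  have h1 : (densityMeasure f).real ({x | f x < ε} ∩ Metric.ball 0 R) ≤
      ε * volume.real (Metric.ball (0 : EuclideanSpace ℝ (Fin d)) R) := by
    have : densityMeasure f ({x | f x < ε} ∩ Metric.ball 0 R) ≤
        ENNReal.ofReal ε * volume (Metric.ball (0 : EuclideanSpace ℝ (Fin d)) R) := by
      rw [densityMeasure, withDensity_apply _ hm]
      calc _ ≤ ∫⁻ x in {x | f x < ε} ∩ Metric.ball 0 R, ENNReal.ofReal ε :=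
            setLIntegral_mono' hm fun x hx => ENNReal.ofReal_le_ofReal (le_of_lt hx.1)
        _ ≤ _ := by
            rw [setLIntegral_const]
            gcongr
            exact Set.inter_subset_right
    have h := ENNReal.toReal_mono
      (ENNReal.mul_ne_top ENNReal.ofReal_ne_top measure_ball_lt_top.ne) this
    rwa [ENNReal.toReal_mul, ENNReal.toReal_ofReal hε] at h
  calc (densityMeasure f).real {x | f x < ε}
      ≤ (densityMeasure f).real ({x | R ≤ ‖x‖} ∪ ({x | f x < ε} ∩ Metric.ball 0 R)) := by
        refine measureReal_mono fun x hx => ?_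
        rcases le_or_gt R ‖x‖ with h | h
        · exact .inl h
        · exact .inr ⟨hx, by simpa using h⟩
    _ ≤ _ := (measureReal_union_le _ _).trans (add_le_add (measureReal_norm_ge_le hf hR) h1)

omit hf in
theorem convex_superlevel (hf : IsLogConcave f) {ε : ℝ} (hε : 0 < ε) : Convex ℝ {x | ε ≤ f x} := by
  rw [convex_iff_forall_pos]
  intro x hx y hy a b ha hb hab
  refine le_trans ?_ (hf.2 x y a b ha hb hab)
  calc ε = ε ^ a * ε ^ b := by rw [← Real.rpow_add hε, hab, Real.rpow_one]
    _ ≤ f x ^ a * f y ^ b := by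
      gcongr
      · exact Real.rpow_nonneg (hf.1 x) a
      · exact hx
      · exact hy

/-- If `f x₀ < ε`, Hahn–Banach separates `x₀` from the closed convex set `{ε ≤ f}`. Since `‖x₀‖ ≤
1/4`, the half-space at distance `1/4` in the separating direction lies in `{f < ε}` and carries too
much mass. -/
theorem le_of_measureReal_lt_le {ε : ℝ} (hε : 0 < ε)
    (h : (densityMeasure f).real {x | f x < ε} ≤ Real.exp (-3) / 2)
    {x₀ : EuclideanSpace ℝ (Fin d)} (hx₀ : ‖x₀‖ ≤ 1 / 4) : ε ≤ f x₀ := by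
  have := isProbabilityMeasure_densityMeasure hf.1
  by_contra! hlt
  have hclosed : IsClosed {x | ε ≤ f x} := hf.1.1.isClosed_preimage ε
  obtain ⟨g, u, hg, hgu⟩ := geometric_hahn_banach_closed_point
    (convex_superlevel hf.1.2.1 hε) hclosed (x := x₀) (by simpa using hlt)
  set v := (InnerProductSpace.toDual ℝ (EuclideanSpace ℝ (Fin d))).symm g with hv
  have hgv : ∀ x, g x = inner ℝ v x := fun x => by rw [hv, InnerProductSpace.toDual_symm_apply]
  have hsub : {x | ‖v‖ / 4 ≤ inner ℝ v x} ⊆ {x | f x < ε} := by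
    intro x hx
    by_contra hcon
    have h1 := hg x (show ε ≤ f x from not_lt.1 hcon)
    have h2 : ‖v‖ / 4 ≤ inner ℝ v x := hx
    have h3 := real_inner_le_norm v x₀
    rw [hgv] at h1 hgu
    nlinarith [norm_nonneg v]
  -- A zero functional can only separate when `{ε ≤ f}` is empty; then `{f < ε}` has mass `1`.
  by_cases hv0 : v = 0
  · have : (densityMeasure f).real {x | f x < ε} = 1 := by
      have e : {x | f x < ε} = Set.univ := by
        refine Set.eq_univ_of_univ_subset (subset_trans (fun x _ => ?_) hsub)
        simp [hv0]
      rw [e, probReal_univ]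
    have : Real.exp (-3) ≤ 1 := Real.exp_le_one_iff.2 (by norm_num)
    linarith
  · have hvn : 0 < ‖v‖ := norm_pos_iff.2 hv0
    have hw : ‖(‖v‖⁻¹ • v)‖ = 1 := by
      rw [norm_smul, norm_inv, norm_norm, inv_mul_cancel₀ hvn.ne']
    have hlow := exp_neg_three_half_lt_measureReal_halfspace hf hw
    have : (densityMeasure f).real {x | 1 / 4 ≤ inner ℝ (‖v‖⁻¹ • v) x} ≤
        (densityMeasure f).real {x | f x < ε} := by
      refine measureReal_mono (subset_trans (fun x hx => ?_) hsub)
      have hx : 1 / 4 ≤ inner ℝ (‖v‖⁻¹ • v) x := hx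
      rw [real_inner_smul_left, inv_mul_eq_div, le_div_iff₀ hvn] at hx
      change ‖v‖ / 4 ≤ inner ℝ v x
      linarith
    linarith

end Density

/-- Isotropic log-concave densities are uniformly bounded below on the ball of radius `1/4`. -/
theorem exists_pos_le_of_isotropic (d : ℕ) :
    ∃ c : ℝ, 0 < c ∧ ∀ f ∈ logConcaveDensitiesWith d 0 1, ∀ x, ‖x‖ ≤ 1 / 4 → c ≤ f x := by
  -- `R` and `ε` are chosen so that each term of `measureReal_lt_le` is at most `exp (-3) / 4`.
  set R : ℝ := Real.sqrt (4 * (d + 1) * Real.exp 3)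
  have hR : 0 < R := by positivity
  set V := volume.real (Metric.ball (0 : EuclideanSpace ℝ (Fin d)) R)
  have hV : 0 ≤ V := measureReal_nonneg
  refine ⟨Real.exp (-3) / (4 * (V + 1)), by positivity, fun f hf x hx => ?_⟩
  refine le_of_measureReal_lt_le hf (by positivity) ?_ hx
  refine (measureReal_lt_le hf hR (by positivity)).trans ?_
  have h1 : (d : ℝ) / R ^ 2 ≤ Real.exp (-3) / 4 := by
    rw [Real.sq_sqrt (by positivity), Real.exp_neg, div_le_div_iff₀ (by positivity) (by norm_num)]
    field_simp
    linarith
  have h2 : Real.exp (-3) / (4 * (V + 1)) * V ≤ Real.exp (-3) / 4 := by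
    rw [div_mul_eq_mul_div, div_le_div_iff₀ (by positivity) (by norm_num)]
    nlinarith [Real.exp_pos (-3)]
  linarith

/-! ### Exponential upper envelope -/

section Upper

variable {d : ℕ} {f : EuclideanSpace ℝ (Fin d) → ℝ}

/-- Each point of the ball is `l • x + (1 - l) • y` with `‖y‖ ≤ (1/8) / (1 - l) ≤ 1/4`, so
log-concavity gives `f ≥ f x ^ l * c ^ (1 - l)` there. -/
theorem rpow_mul_rpow_mul_volume_ball_le (hf : f ∈ logConcaveDensities d) {c : ℝ} (hc : 0 < c)
    (hfc : ∀ x, ‖x‖ ≤ 1 / 4 → c ≤ f x) (x : EuclideanSpace ℝ (Fin d)) {l : ℝ} (hl : 0 < l)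
    (hl2 : l ≤ 1 / 2) :
    f x ^ l * c ^ (1 - l) * volume.real (Metric.ball (0 : EuclideanSpace ℝ (Fin d)) (1 / 8)) ≤
      (densityMeasure f).real (Metric.ball (l • x) (1 / 8)) := by
  have := isProbabilityMeasure_densityMeasure hf
  have hl1 : 0 < 1 - l := by linarith
  have hle : ∀ z ∈ Metric.ball (l • x) (1 / 8), f x ^ l * c ^ (1 - l) ≤ f z := by
    intro z hz
    have hz' : ‖z - l • x‖ < 1 / 8 := by rwa [mem_ball_iff_norm] at hz
    set y := (1 - l)⁻¹ • (z - l • x) with hy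
    have hyn : ‖y‖ ≤ 1 / 4 := by
      rw [hy, norm_smul, norm_inv, Real.norm_of_nonneg hl1.le, inv_mul_le_iff₀ hl1]
      nlinarith
    have hzy : l • x + (1 - l) • y = z := by
      rw [hy, smul_inv_smul₀ hl1.ne']; abel
    calc f x ^ l * c ^ (1 - l) ≤ f x ^ l * f y ^ (1 - l) := by
          gcongr
          · exact Real.rpow_nonneg (hf.2.1.1 x) _
          · exact hfc y hyn
      _ ≤ f z := by
          have := hf.2.1.2 x y l (1 - l) hl hl1 (by ring)
          rwa [hzy] at this
  have hK : 0 ≤ f x ^ l * c ^ (1 - l) :=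
    mul_nonneg (Real.rpow_nonneg (hf.2.1.1 x) _) (Real.rpow_nonneg hc.le _)
  have h : ENNReal.ofReal (f x ^ l * c ^ (1 - l)) * volume (Metric.ball (l • x) (1 / 8)) ≤
      densityMeasure f (Metric.ball (l • x) (1 / 8)) := by
    rw [densityMeasure, withDensity_apply _ measurableSet_ball, ← setLIntegral_const]
    exact setLIntegral_mono' measurableSet_ball fun z hz => ENNReal.ofReal_le_ofReal (hle z hz)
  have h' := ENNReal.toReal_mono (measure_ne_top _ _) h
  rw [ENNReal.toReal_mul, ENNReal.toReal_ofReal hK] at h'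
  rwa [measureReal_def, ← Measure.addHaar_ball_center volume (l • x) (1 / 8)]

theorem le_of_le_on_ball (hf : f ∈ logConcaveDensities d) {c : ℝ} (hc : 0 < c)
    (hfc : ∀ x, ‖x‖ ≤ 1 / 4 → c ≤ f x) (x : EuclideanSpace ℝ (Fin d)) :
    f x ≤ 1 / (c * volume.real (Metric.ball (0 : EuclideanSpace ℝ (Fin d)) (1 / 8)) ^ 2) := by
  have := isProbabilityMeasure_densityMeasure hf
  set v := volume.real (Metric.ball (0 : EuclideanSpace ℝ (Fin d)) (1 / 8)) with hv
  have hv0 : 0 < v := ENNReal.toReal_pos (Metric.measure_ball_pos _ _ (by norm_num)).ne'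
    measure_ball_lt_top.ne
  have h := (rpow_mul_rpow_mul_volume_ball_le hf hc hfc x (l := 1 / 2) (by norm_num) le_rfl).trans
    measureReal_le_one
  rw [← hv, show (1 : ℝ) - 1 / 2 = 1 / 2 by norm_num, ← Real.sqrt_eq_rpow, ← Real.sqrt_eq_rpow] at h
  rw [le_div_iff₀ (by positivity)]
  have h2 := pow_le_one₀ (n := 2) (by positivity) h
  rw [mul_pow, mul_pow, Real.sq_sqrt (hf.2.1.1 x), Real.sq_sqrt hc.le] at h2
  linarith

/-- Taking `l = r / ‖x‖` centres the ball at distance `r` from the origin, where Chebyshev bounds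
its mass by `c * v * exp (-1)`, with `v` the volume of the ball. Hence `f x ^ l ≤ c ^ l * exp (-1)`,
and taking the `l`-th root gives the decay rate `1 / r`. -/
theorem le_exp_of_le_on_ball (hf : f ∈ logConcaveDensitiesWith d 0 1) {c : ℝ} (hc : 0 < c)
    (hfc : ∀ x, ‖x‖ ≤ 1 / 4 → c ≤ f x) {r : ℝ} (hr : 1 / 8 < r)
    (hr2 : d / (r - 1 / 8) ^ 2 ≤
      c * volume.real (Metric.ball (0 : EuclideanSpace ℝ (Fin d)) (1 / 8)) * Real.exp (-1))
    {x : EuclideanSpace ℝ (Fin d)} (hx : 2 * r ≤ ‖x‖) :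
    f x ≤ c * Real.exp (-(1 / r) * ‖x‖) := by
  have := isProbabilityMeasure_densityMeasure hf.1
  have hr0 : 0 < r := by linarith
  have hx0 : 0 < ‖x‖ := by linarith
  have hl : 0 < r / ‖x‖ := by positivity
  have hl2 : r / ‖x‖ ≤ 1 / 2 := by rw [div_le_div_iff₀ hx0 two_pos]; linarith
  set v := volume.real (Metric.ball (0 : EuclideanSpace ℝ (Fin d)) (1 / 8)) with hv
  have hv0 : 0 < v := ENNReal.toReal_pos (Metric.measure_ball_pos _ _ (by norm_num)).ne'
    measure_ball_lt_top.ne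
  have h1 := rpow_mul_rpow_mul_volume_ball_le hf.1 hc hfc x hl hl2
  have h2 : (densityMeasure f).real (Metric.ball ((r / ‖x‖) • x) (1 / 8)) ≤
      (densityMeasure f).real {z | r - 1 / 8 ≤ ‖z‖} := by
    refine measureReal_mono fun z hz => ?_
    rw [mem_ball_iff_norm] at hz
    have hn : ‖(r / ‖x‖) • x‖ = r := by
      rw [norm_smul, Real.norm_of_nonneg hl.le, div_mul_cancel₀ _ hx0.ne']
    have := norm_sub_norm_le ((r / ‖x‖) • x) z
    rw [norm_sub_rev, hn] at this
    change r - 1 / 8 ≤ ‖z‖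
    linarith
  have h3 := (h1.trans h2).trans ((measureReal_norm_ge_le hf (by linarith)).trans hr2)
  have h4 : f x ^ (r / ‖x‖) ≤ (c * Real.exp (-(1 / r) * ‖x‖)) ^ (r / ‖x‖) := by
    rw [Real.mul_rpow hc.le (Real.exp_pos _).le, ← Real.exp_mul]
    have e : -(1 / r) * ‖x‖ * (r / ‖x‖) = -1 := by field_simp
    rw [e]
    have hcp : 0 < c ^ (1 - r / ‖x‖) * v := by positivity
    refine le_of_mul_le_mul_right ?_ hcp
    calc f x ^ (r / ‖x‖) * (c ^ (1 - r / ‖x‖) * v) ≤ c * v * Real.exp (-1) := by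
          rw [← mul_assoc]; exact h3
      _ = c ^ (r / ‖x‖) * c ^ (1 - r / ‖x‖) * v * Real.exp (-1) := by
          rw [← Real.rpow_add hc, add_sub_cancel, Real.rpow_one]
      _ = _ := by ring
  exact (Real.rpow_le_rpow_iff (hf.1.2.1.1 x) (by positivity) hl).1 h4

end Upper

/-- Isotropic log-concave densities have a common exponentially decaying envelope. -/
theorem exists_le_exp_of_isotropic (d : ℕ) :
    ∃ A B : ℝ, 0 < A ∧ 0 < B ∧ ∀ f ∈ logConcaveDensitiesWith d 0 1, ∀ x,
      f x ≤ Real.exp (-A * ‖x‖ + B) := by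
  obtain ⟨c, hc, hfc⟩ := exists_pos_le_of_isotropic d
  set v := volume.real (Metric.ball (0 : EuclideanSpace ℝ (Fin d)) (1 / 8)) with hv
  have hv0 : 0 < v := ENNReal.toReal_pos (Metric.measure_ball_pos _ _ (by norm_num)).ne'
    measure_ball_lt_top.ne
  -- Solves the Chebyshev condition on `r - 1/8`; `d + 1` in place of `d` keeps `q` positive even
  -- for `d = 0`.
  set q := Real.sqrt ((d + 1) / (c * v * Real.exp (-1))) with hq
  have hq0 : 0 < q := by positivity
  set r := 1 / 8 + q with hr
  have hr0 : 0 < r := by positivity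
  have hr2 : d / (r - 1 / 8) ^ 2 ≤ c * v * Real.exp (-1) := by
    rw [hr, add_sub_cancel_left, hq, Real.sq_sqrt (by positivity), div_div_eq_mul_div,
      div_le_iff₀ (by positivity)]
    have : 0 < c * v * Real.exp (-1) := by positivity
    nlinarith
  set M := 1 / (c * v ^ 2) with hM
  have hM0 : 0 < M := by positivity
  -- The `2` absorbs `‖x‖ / r` on the ball `‖x‖ < 2 * r`, where the constant bound `M` is used; `log
  -- c` serves the decaying bound outside.
  refine ⟨1 / r, 2 + |Real.log M| + |Real.log c|, by positivity, by positivity, fun f hf x => ?_⟩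
  rcases le_or_gt (2 * r) ‖x‖ with h | h
  · refine (le_exp_of_le_on_ball hf hc (hfc f hf) (by linarith) hr2 h).trans ?_
    nth_rewrite 1 [← Real.exp_log hc]
    rw [← Real.exp_add, Real.exp_le_exp]
    linarith [le_abs_self (Real.log c), abs_nonneg (Real.log M)]
  · refine (le_of_le_on_ball hf.1 hc (hfc f hf) x).trans ?_
    rw [← hv, ← hM, ← Real.log_le_iff_le_exp hM0]
    have : 1 / r * ‖x‖ ≤ 2 := by
      rw [one_div, inv_mul_le_iff₀ hr0]; linarith
    linarith [le_abs_self (Real.log M), abs_nonneg (Real.log c)]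

/-- Suprema and infima are taken in the complete lattice `EReal`, so that they are genuine. -/
theorem theorem3p4 (d : ℕ) (hd : 1 ≤ d) :
    (∃ A B : ℝ, 0 < A ∧ 0 < B ∧ ∀ x : EuclideanSpace ℝ (Fin d),
      (⨆ f ∈ logConcaveDensitiesWith d 0 1, ((f x : ℝ) : EReal)) ≤
        ((Real.exp (-A * ‖x‖ + B) : ℝ) : EReal)) ∧
    (∀ x : EuclideanSpace ℝ (Fin d), ‖x‖ ≤ 1 / 4 →
      (0 : EReal) < ⨅ f ∈ logConcaveDensitiesWith d 0 1, ((f x : ℝ) : EReal)) := by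
  constructor
  · obtain ⟨A, B, hA, hB, h⟩ := exists_le_exp_of_isotropic d
    exact ⟨A, B, hA, hB, fun x => iSup₂_le fun f hf => EReal.coe_le_coe_iff.2 (h f hf x)⟩
  · intro x hx
    obtain ⟨c, hc, h⟩ := exists_pos_le_of_isotropic d
    exact (EReal.coe_pos.2 hc).trans_le
      (le_iInf₂ fun f hf => EReal.coe_le_coe_iff.2 (h f hf x hx))
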